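/- Let $k$ be a number field with algebraic closure $\bar k$, and let $\mathcal A$ be an abelian variety over $k$ of $\mathrm{GL}_2$-type: there are a number field $E$ with $[E:\mathbb Q]=\dim\mathcal A$ and an embedding $\phi\colon E\hookrightarrow \mathrm{End}_k(\mathcal A)\otimes\mathbb Q$. Let $R=\phi^{-1}(\mathrm{End}_k(\mathcal A)\otimes\mathbb Z)$, an order of $E$ which acts on $\mathcal A$ through the embedding $R\hookrightarrow\mathrm{End}_k(\mathcal A)$ induced by $\phi$. Let $p\ge 5$ be a prime number that is good, i.e. does not divide the index $[\mathcal O_E:R]$, and that is unramified in $E$. Let $\mathcal P$ be a prime ideal of $R$ containing $p$, put $\mathbb F_q=R/\mathcal P$, and for $n\ge 0$ put $\mathcal A[\mathcal P^n]=\{x\in\mathcal A(\bar k) : \alpha x=0 \text{ for all } \alpha\in\mathcal P^n\}$. Let $G_{\mathcal P,n}$ be the group of automorphisms of $\mathcal A[\mathcal P^n]$ induced by $\mathrm{Gal}(\bar k/k)$. Fix an $\mathbb F_q$-basis of $\mathcal A[\mathcal P]\simeq\mathbb F_q^2$, so that $G_{\mathcal P,1}$ becomes a subgroup of $\mathrm{GL}_2(\mathbb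 F_q)$. For a group $\Gamma$ and a $\Gamma$-module $M$, let $H^1_{\mathrm{loc}}(\Gamma,M)\subseteq H^1(\Gamma,M)$ be the subgroup of the classes of the cocycles $Z\colon\Gamma\to M$ such that for every $\gamma\in\Gamma$ there is $m_\gamma\in M$ with $Z_\gamma=\gamma m_\gamma-m_\gamma$. Suppose that $\{\det g : g\in G_{\mathcal P,1}\}=\mathbb F_p^\ast$ and that $H^1_{\mathrm{loc}}(G_{\mathcal P,n},\mathcal A[\mathcal P^n])\neq 0$ for some $n\in\mathbb N$. Then $G_{\mathcal P,1}$ is contained in a Borel subgroup of $\mathrm{GL}_2(\mathbb F_q)$; it has a unique $p$-Sylow subgroup $N$; and $G_{\mathcal P,1}$ is generated by $N$ and an element $g\in G_{\mathcal P,1}$ whose order divides $q-1$ and whose determinant has order $p-1$. -/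

import Mathlib

universe u v

namespace GL2Type

open CategoryTheory AlgebraicGeometry
open scoped TensorProduct

/-- An abelian variety over the field `k`: a proper, geometrically integral group scheme
over `Spec k`. -/
structure AbelianVariety (k : Type u) [Field k] where
  /-- the underlying scheme over `Spec k` -/
  X : Over (Spec (CommRingCat.of k))
  [grp : GrpObj X]
  [proper : IsProper X.hom]
  [integral : GeometricallyIntegral X.hom]

attribute [instance] AbelianVariety.grp AbelianVariety.proper AbelianVariety.integral

namespace AbelianVariety

open scoped MonObj

variable {k : Type u} [Field k] (A : AbelianVariety k)

instance : IsCommMonObj A.X := isCommMonObj_of_isProper_of_geometricallyIntegral A.X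

/-- The absolute Galois group `Gal(k̄/k)`. -/
abbrev AbsGal (k : Type u) [Field k] : Type u := AlgebraicClosure k ≃ₐ[k] AlgebraicClosure k

/-- `Spec k̄` as a scheme over `Spec k`. -/
noncomputable def geomPt (k : Type u) [Field k] : Over (Spec (CommRingCat.of k)) :=
  Over.mk (Spec.map (CommRingCat.ofHom (algebraMap k (AlgebraicClosure k))))

/-- The automorphism `Spec σ` of `Spec k̄` over `Spec k`. -/
noncomputable def geomPtMap (σ : AbsGal k) : geomPt k ⟶ geomPt k :=
  Over.homMk (Spec.map (CommRingCat.ofHom (σ : AlgebraicClosure k →+* AlgebraicClosure k))) (by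
    dsimp [geomPt]
    rw [← Spec.map_comp, ← CommRingCat.ofHom_comp]
    congr 2
    ext x
    simp)

lemma geomPtMap_one : geomPtMap (1 : AbsGal k) = 𝟙 _ := by
  ext1
  exact Spec.map_id _

lemma geomPtMap_mul (σ τ : AbsGal k) : geomPtMap (σ * τ) = geomPtMap σ ≫ geomPtMap τ := by
  ext1
  exact Spec.map_comp (CommRingCat.ofHom (τ : AlgebraicClosure k →+* AlgebraicClosure k))
    (CommRingCat.ofHom (σ : AlgebraicClosure k →+* AlgebraicClosure k))

/-- The group `A(k̄)` of geometric points, written additively. -/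
def Points : Type u := Additive (geomPt k ⟶ A.X)

noncomputable instance : AddCommGroup A.Points :=
  inferInstanceAs (AddCommGroup (Additive (geomPt k ⟶ A.X)))

/-- The action of `Gal(k̄/k)` on `A(k̄)`. -/
noncomputable instance : DistribMulAction (AbsGal k) A.Points where
  smul σ x := Additive.ofMul (geomPtMap σ ≫ x.toMul)
  one_smul x := by
    change Additive.ofMul (geomPtMap 1 ≫ x.toMul) = x
    rw [geomPtMap_one, Category.id_comp]; rfl
  mul_smul σ τ x := by
    change Additive.ofMul (geomPtMap (σ * τ) ≫ x.toMul) =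
      Additive.ofMul (geomPtMap σ ≫ geomPtMap τ ≫ x.toMul)
    rw [geomPtMap_mul, Category.assoc]
  smul_zero σ := congrArg Additive.ofMul (MonObj.comp_one (M := A.X) (geomPtMap σ))
  smul_add σ x y := congrArg Additive.ofMul (MonObj.comp_mul (geomPtMap σ) x.toMul y.toMul)

/-- `End_k(A)`: the endomorphisms of the group scheme `A` over `k`. -/
def EndRing : Type u := Additive (Grp.mk A.X ⟶ Grp.mk A.X)

noncomputable instance : AddCommGroup A.EndRing :=
  inferInstanceAs (AddCommGroup (Additive (Grp.mk A.X ⟶ Grp.mk A.X)))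

/-- The ring structure on `End_k(A)`: pointwise addition, and `f * g = f ∘ g`. -/
noncomputable instance : Ring A.EndRing where
  __ := (inferInstance : AddCommGroup A.EndRing)
  mul f g := Additive.ofMul (g.toMul ≫ f.toMul)
  one := Additive.ofMul (𝟙 (Grp.mk A.X))
  left_distrib f g h := congrArg Additive.ofMul (MonObj.mul_comp g.toMul h.toMul f.toMul)
  right_distrib f g h := congrArg Additive.ofMul (MonObj.comp_mul h.toMul f.toMul g.toMul)
  zero_mul f := congrArg Additive.ofMul (MonObj.comp_one (M := Grp.mk A.X) f.toMul)
  mul_zero f := congrArg Additive.ofMul (MonObj.one_comp (M := Grp.mk A.X) f.toMul)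
  mul_assoc f g h := congrArg Additive.ofMul (Category.assoc h.toMul g.toMul f.toMul).symm
  one_mul f := congrArg Additive.ofMul (Category.comp_id f.toMul)
  mul_one f := congrArg Additive.ofMul (Category.id_comp f.toMul)

/-- `End_k(A)` acts on `A(k̄)`. -/
noncomputable instance : Module A.EndRing A.Points where
  smul f x := Additive.ofMul (x.toMul ≫ f.toMul.hom.hom)
  one_smul x := congrArg Additive.ofMul (Category.comp_id x.toMul)
  mul_smul f g x :=
    congrArg Additive.ofMul (Category.assoc x.toMul g.toMul.hom.hom f.toMul.hom.hom).symm
  smul_zero f := congrArg Additive.ofMul (MonObj.one_comp f.toMul.hom.hom)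
  smul_add f x y := congrArg Additive.ofMul (MonObj.mul_comp x.toMul y.toMul f.toMul.hom.hom)
  add_smul f g x :=
    congrArg Additive.ofMul (MonObj.comp_mul x.toMul f.toMul.hom.hom g.toMul.hom.hom)
  zero_smul x := congrArg Additive.ofMul (MonObj.comp_one (M := A.X) x.toMul)

instance : SMulCommClass (AbsGal k) A.EndRing A.Points where
  smul_comm σ f x :=
    congrArg Additive.ofMul (Category.assoc (geomPtMap σ) x.toMul f.toMul.hom.hom).symm

end AbelianVariety

open AbelianVariety

/-- The image `End_k(A) ⊗ ℤ` of `End_k(A)` in `ℚ ⊗ End_k(A)`. -/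
noncomputable def AbelianVariety.integralEnd {k : Type u} [Field k] (A : AbelianVariety k) :
    Subring (ℚ ⊗[ℤ] A.EndRing) :=
  (Algebra.TensorProduct.includeRight : A.EndRing →ₐ[ℤ] ℚ ⊗[ℤ] A.EndRing).toRingHom.range

/-- The data exhibiting `A` as a variety of `GL₂`-type: an embedding `φ : E → End_k(A) ⊗ ℚ`
of a number field `E` of degree `dim A`. With `R = φ⁻¹(End_k(A) ⊗ ℤ)`, the map `toEnd` is the
embedding `R → End_k(A)` induced by `φ`. -/
structure Embedding {k : Type u} [Field k] (A : AbelianVariety k)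
    (E : Type v) [Field E] [NumberField E] where
  φ : E →+* ℚ ⊗[ℤ] A.EndRing
  φ_injective : Function.Injective φ
  finrank_eq_dim : ((Module.finrank ℚ E : ℕ) : WithBot ℕ∞) = topologicalKrullDim A.X.left
  toEnd : A.integralEnd.comap φ →+* A.EndRing
  one_tmul_toEnd : ∀ r : A.integralEnd.comap φ, (1 : ℚ) ⊗ₜ[ℤ] toEnd r = φ r

namespace Embedding

variable {k : Type u} [Field k] {A : AbelianVariety k} {E : Type v} [Field E] [NumberField E]
  (S : Embedding A E)

/-- The order `R = φ⁻¹(End_k(A) ⊗ ℤ)` of `E`. -/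
noncomputable abbrev order : Subring E := A.integralEnd.comap S.φ

/-- The prime `p` is good: it does not divide the index `[𝓞_E : R]`
(an infinite index counts as `0`, hence is divisible by `p`). -/
def IsGood (p : ℕ) : Prop :=
  ¬ p ∣ S.order.toAddSubgroup.relIndex (integralClosure ℤ E).toSubring.toAddSubgroup

/-- The group `A(k̄)`, with its structure of `R`-module. -/
def Points (_S : Embedding A E) : Type u := A.Points

noncomputable instance : AddCommGroup S.Points := inferInstanceAs (AddCommGroup A.Points)

noncomputable instance : DistribMulAction (AbsGal k) S.Points :=
  inferInstanceAs (DistribMulAction (AbsGal k) A.Points)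

noncomputable instance : Module S.order S.Points :=
  Module.compHom A.Points S.toEnd

instance : SMulCommClass (AbsGal k) S.order S.Points where
  smul_comm σ r x := smul_comm (M := AbsGal k) (N := A.EndRing) (α := A.Points) σ (S.toEnd r) x

/-- `A[I] = {x ∈ A(k̄) | α x = 0 for all α ∈ I}`, for an ideal `I` of `R`. It is a module over
`R ⧸ I`. -/
noncomputable abbrev torsion (I : Ideal S.order) : Submodule S.order S.Points :=
  Submodule.torsionBySet S.order S.Points I

lemma smul_mem_torsion (I : Ideal S.order) (σ : AbsGal k) {x : S.Points} (hx : x ∈ S.torsion I) :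
    σ • x ∈ S.torsion I := by
  rw [Submodule.mem_torsionBySet_iff] at hx ⊢
  intro a
  have h : (a : S.order) • x = 0 := hx a
  change (a : S.order) • σ • x = 0
  rw [← smul_comm, h, smul_zero]

/-- The action of `Gal(k̄/k)` on `A[I]`, which is linear over `R ⧸ I`. -/
noncomputable def galRep (I : Ideal S.order) :
    AbsGal k →* LinearMap.GeneralLinearGroup (S.order ⧸ I) (S.torsion I) :=
  MonoidHom.toHomUnits
    { toFun σ :=
        { toFun x := ⟨σ • (x : S.Points), S.smul_mem_torsion I σ x.2⟩
          map_add' x y := Subtype.ext (smul_add σ (x : S.Points) (y : S.Points))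
          map_smul' := by
            intro c x
            obtain ⟨r, rfl⟩ := Ideal.Quotient.mk_surjective c
            exact Subtype.ext (smul_comm σ r (x : S.Points)) }
      map_one' := LinearMap.ext fun x => Subtype.ext (one_smul (AbsGal k) (x : S.Points))
      map_mul' σ τ := LinearMap.ext fun x => Subtype.ext (mul_smul σ τ (x : S.Points)) }

/-- The group of automorphisms of `A[I]` induced by `Gal(k̄/k)`.
For `I = P ^ n` this is `G_{P,n}`. -/
noncomputable def galImage (I : Ideal S.order) :
    Subgroup (LinearMap.GeneralLinearGroup (S.order ⧸ I) (S.torsion I)) :=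
  (S.galRep I).range

/-- The group `galImage I`, as a group of matrices with respect to the basis `b` of `A[I]`. -/
noncomputable def matrixImage (I : Ideal S.order)
    (b : Module.Basis (Fin 2) (S.order ⧸ I) (S.torsion I)) :
    Subgroup (Matrix.GeneralLinearGroup (Fin 2) (S.order ⧸ I)) :=
  (S.galImage I).comap (Matrix.GeneralLinearGroup.toLin' b).toMonoidHom

end Embedding

/-- The first local cohomology group `H¹_loc(Γ, M)`: the classes in `H¹(Γ, M)` of the cocycles `Z`
such that for every `γ` there is `m` with `Z γ = γ m - m`. -/
noncomputable def H1loc (Γ M : Type) [Group Γ] [AddCommGroup M] [DistribMulAction Γ M] :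
    Submodule ℤ (groupCohomology.H1 (Rep.ofDistribMulAction ℤ Γ M)) :=
  Submodule.map (groupCohomology.H1π (Rep.ofDistribMulAction ℤ Γ M)).hom
    { carrier := {Z | ∀ γ : Γ, ∃ m : M, Z γ = γ • m - m}
      zero_mem' := fun γ => ⟨0, (show (0 : M) = γ • (0 : M) - 0 by simp)⟩
      add_mem' := by
        intro Z W hZ hW γ
        obtain ⟨m, hm⟩ := hZ γ
        obtain ⟨m', hm'⟩ := hW γ
        have h : (γ • m - m) + (γ • m' - m') = γ • (m + m') - (m + m') := by
          rw [smul_add]; abel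
        exact ⟨m + m', (congrArg₂ (fun x y : M => x + y) hm hm').trans h⟩
      smul_mem' := by
        intro c Z hZ γ
        obtain ⟨m, hm⟩ := hZ γ
        have h : c • (γ • m - m) = γ • (c • m) - c • m := by
          rw [smul_sub, smul_comm c γ m]
        exact ⟨c • m, (congrArg (fun x : M => c • x) hm).trans h⟩ }

/-- A subgroup of `GL₂(F)` is a Borel subgroup if it is conjugate to the group of upper
triangular matrices. -/
def IsBorel {F : Type*} [CommRing F] (B : Subgroup (Matrix.GeneralLinearGroup (Fin 2) F)) : Prop :=
  ∃ h : Matrix.GeneralLinearGroup (Fin 2) F, ∀ g : Matrix.GeneralLinearGroup (Fin 2) F,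
    g ∈ B ↔ (h * g * h⁻¹ : Matrix.GeneralLinearGroup (Fin 2) F) 1 0 = 0

end GL2Type

/-!
Put `F = R ⧸ P`, a finite field with `q` elements, and let `H ≤ GL₂(F)` be the image of Galois on
`A[P]`. The nonvanishing of cohomology enters only through one consequence: `H` contains no scalar
matrix but `1` (`Embedding.hasNoScalars_matrixImage`). Indeed, suppose that `σ` acts on `A[P]` as
`c ∈ R`. Then `σ - c` maps `A[P ^ (i + 1)]` to `A[P ^ i]`, so it is nilpotent on `A[P ^ n]`, and so
is `p`; hence `σ ^ (p ^ N) = c ^ (p ^ N)` on `A[P ^ n]` for `N` large. This is a central element of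
the Galois image on `A[P ^ n]`, and if `c ≠ 1` modulo `P` then `c ^ (p ^ N) - 1` is invertible
modulo `P ^ n`, so that all of `H¹` vanishes by Sah's lemma.

The rest is about a subgroup `H` of `GL₂(F)` without nontrivial scalars and with `det H = 𝔽_pˣ`. The
matrices commuting with a non-scalar `x` are the `a + b x`, so commuting is transitive on
`H ∖ {1}`. Let `g ∈ H` have determinant `2`, and let `C` be its centralizer. If `w g w⁻¹` commutes
with `g`, it is `g`, or `g` times it is the scalar `det g`, which is impossible since `det g ≠ 1`.
Hence `C` is a commutative Frobenius complement (`HasNoScalars.isIsolated_centralizer`), and the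
transfer `H → C` provides a normal complement `X` of it
(`IsIsolated.exists_normal_complement`). The Frattini argument shows that `X` consists of
unipotent elements (`HasNoScalars.discr_eq_zero_of_mem_kernel`), so `X` is a `p`-group; this uses
`(det g) ^ 2 ≠ 1`. If `X ≠ 1` then `H` preserves the line fixed by a central element of `X`;
otherwise `H = C` and the line is an eigenline of `g`, which exists over `F` because `x ^ q = x`
for every `x ∈ H` with `det x ≠ 1` (`HasNoScalars.pow_card_eq`). Finally `C` is cyclic, since the
ratio of the two eigenvalues embeds it into `Fˣ`; a generator `y` of it has `y ^ (q - 1) = 1`, and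
`det y` generates `det H`.
-/

/-! ### Frobenius complements that are commutative -/

namespace GL2Type

section Frobenius

variable {G : Type*} [Group G]

/-- A subgroup `C` is *isolated* if `C ∩ w C w⁻¹ = 1` for every `w ∉ C`: a Frobenius complement,
the cases `C = 1` and `C = G` included. -/
def IsIsolated (C : Subgroup G) : Prop :=
  ∀ x ∈ C, x ≠ 1 → ∀ w : G, w⁻¹ * x * w ∈ C → w ∈ C

/-- An element of prime order `ℓ` of an isolated subgroup fixes exactly one coset. -/
lemma IsIsolated.index_modEq_one [Finite G] {C : Subgroup G} (hC : IsIsolated C) {x : G}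
    (hx : x ∈ C) {l : ℕ} [hl : Fact l.Prime] (hxl : orderOf x = l) : C.index ≡ 1 [MOD l] := by
  have hx1 : x ≠ 1 := by
    rintro rfl
    exact hl.out.one_lt.ne (by simpa using hxl)
  have hp : IsPGroup l (Subgroup.zpowers x) :=
    IsPGroup.of_card (n := 1) (by rw [Nat.card_zpowers, hxl, pow_one])
  have h := hp.card_modEq_card_fixedPoints (G ⧸ C)
  have hfix : MulAction.fixedPoints (Subgroup.zpowers x) (G ⧸ C) = {((1 : G) : G ⧸ C)} := by
    ext q
    rw [Set.mem_singleton_iff]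
    constructor
    · intro hq
      obtain ⟨w, rfl⟩ := QuotientGroup.mk_surjective q
      have h1 : ((x * w : G) : G ⧸ C) = (w : G ⧸ C) :=
        hq ⟨x, Subgroup.mem_zpowers x⟩
      have h2 : w⁻¹ * x * w ∈ C := by
        have := QuotientGroup.eq.1 h1.symm
        rwa [← mul_assoc] at this
      exact (QuotientGroup.eq.2 (by simpa using hC x hx hx1 w h2)).symm
    · rintro rfl ⟨y, hy⟩
      have hyC : y ∈ C := (Subgroup.zpowers_le.2 hx) hy
      change ((y * 1 : G) : G ⧸ C) = ((1 : G) : G ⧸ C)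
      exact QuotientGroup.eq.2 (by simpa using hyC)
  rw [hfix] at h
  simpa [Subgroup.index] using h

/-- Frobenius' theorem for a commutative complement: the transfer `G → C` is `x ↦ x ^ [G : C]`
on `C`, where it is injective because `[G : C]` is prime to the order of `C`, and its kernel is
the Frobenius kernel. -/
theorem IsIsolated.exists_normal_complement [Finite G] {C : Subgroup G} (hC : IsIsolated C)
    (hcomm : ∀ x ∈ C, ∀ y ∈ C, x * y = y * x) :
    ∃ X : Subgroup G, X.Normal ∧ X ⊓ C = ⊥ ∧ X ⊔ C = ⊤ := by
  let _ : CommGroup C :=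
    { (inferInstance : Group C) with
      mul_comm := fun x y => Subtype.ext (hcomm x x.2 y y.2) }
  let V : G →* C := MonoidHom.transfer (MonoidHom.id C)
  have hV : ∀ x : C, V x = x ^ C.index := by
    intro x
    refine (MonoidHom.transfer_eq_pow (MonoidHom.id C) (x : G) ?_).trans (Subtype.ext ?_)
    · intro k w hw
      by_cases h1 : (x : G) ^ k = 1
      · simp [h1]
      · have hwC := hC _ (pow_mem x.2 k) h1 w hw
        rw [mul_assoc, hcomm _ (pow_mem x.2 k) w hwC, inv_mul_cancel_left]
    · simp
  have hinj : ∀ x : C, V x = 1 → x = 1 := by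
    intro x hx
    by_contra hne
    rw [hV] at hx
    obtain ⟨l, hl, hlx⟩ := Nat.exists_prime_and_dvd (mt orderOf_eq_one_iff.1 hne)
    have : Fact l.Prime := ⟨hl⟩
    obtain ⟨y, hy⟩ := exists_prime_orderOf_dvd_card' l (hlx.trans (orderOf_dvd_natCard x))
    have h1 := hC.index_modEq_one y.2 (l := l) (by rw [Subgroup.orderOf_coe, hy])
    have h2 : l ∣ C.index := hlx.trans (orderOf_dvd_of_pow_eq_one hx)
    exact hl.one_lt.ne' (Nat.dvd_one.1 ((h1.dvd_iff dvd_rfl).1 h2))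
  have hbij : Function.Bijective fun x : C => V x := by
    refine Finite.injective_iff_bijective.1 fun x y hxy => ?_
    have : V ((x / y : C) : G) = 1 := by
      rw [Subgroup.coe_div, map_div, div_eq_one]
      exact hxy
    exact div_eq_one.1 (hinj _ this)
  refine ⟨V.ker, inferInstance, ?_, ?_⟩
  · rw [eq_bot_iff]
    rintro x ⟨hx, hxC⟩
    exact Subgroup.mem_bot.2 (congrArg Subtype.val (hinj ⟨x, hxC⟩ hx))
  · rw [eq_top_iff]
    intro y _
    obtain ⟨c, hc⟩ := hbij.2 (V y)
    have hk : y * (c : G)⁻¹ ∈ V.ker := by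
      rw [MonoidHom.mem_ker, map_mul, map_inv]
      exact mul_inv_eq_one.2 hc.symm
    simpa using Subgroup.mul_mem_sup hk c.2

/-- If `X` is a normal complement of `C` and no element of `C ∖ 1` commutes with an element of
`X ∖ 1`, then conjugation by `X` is transitive on each coset `X c ≠ X`; so every element outside
`X` is conjugate to an element of `C`. -/
lemma exists_conj_mem_of_notMem [Finite G] {X C : Subgroup G} [X.Normal] (hsup : X ⊔ C = ⊤)
    (hfree : ∀ c ∈ C, c ≠ 1 → ∀ x ∈ X, x * c = c * x → x = 1) {y : G} (hy : y ∉ X) :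
    ∃ c ∈ C, c ≠ 1 ∧ ∃ w : G, w⁻¹ * y * w = c := by
  have hyt : y ∈ X ⊔ C := hsup ▸ Subgroup.mem_top y
  obtain ⟨x, hx, c, hc, rfl⟩ := Subgroup.mem_sup_of_normal_left.1 hyt
  have hc1 : c ≠ 1 := by
    rintro rfl
    exact hy (by simpa using hx)
  have hf : ∀ w : X, (w : G) * (c * (w : G)⁻¹ * c⁻¹) ∈ X := fun w =>
    X.mul_mem w.2 (Subgroup.Normal.conj_mem inferInstance _ (X.inv_mem w.2) c)
  let f : X → X := fun w => ⟨(w : G) * (c * (w : G)⁻¹ * c⁻¹), hf w⟩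
  have hinj : Function.Injective f := by
    intro v w hvw
    have h : (v : G) * (c * (v : G)⁻¹ * c⁻¹) = w * (c * (w : G)⁻¹ * c⁻¹) :=
      congrArg Subtype.val hvw
    have h1 : ((w : G)⁻¹ * v) * c = c * ((w : G)⁻¹ * v) := by
      have h2 : (v : G) * c * (v : G)⁻¹ = w * c * (w : G)⁻¹ := by
        have := congrArg (· * c) h
        simpa [mul_assoc] using this
      calc ((w : G)⁻¹ * v) * c = (w : G)⁻¹ * ((v : G) * c * (v : G)⁻¹) * v := by group
        _ = c * ((w : G)⁻¹ * v) := by rw [h2]; group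
    have h3 := hfree c hc hc1 _ (X.mul_mem (X.inv_mem w.2) v.2) h1
    exact Subtype.ext (inv_mul_eq_one.1 h3).symm
  obtain ⟨w, hw⟩ := (Finite.injective_iff_surjective.1 hinj) ⟨x, hx⟩
  have hw' : (w : G) * (c * (w : G)⁻¹ * c⁻¹) = x := congrArg Subtype.val hw
  exact ⟨c, hc, hc1, w, by rw [← hw']; group⟩

end Frobenius

/-! ### Commuting `2 × 2` matrices and eigenvectors -/

open Matrix

section TwoByTwo

variable {F : Type*} [Field F]

/-- The centralizer of a non-scalar `2 × 2` matrix `g` consists of the matrices `a + b g`. -/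
lemma exists_eq_smul_add_smul_of_commute {x g : Matrix (Fin 2) (Fin 2) F}
    (hg : ∀ c : F, g ≠ c • 1) (h : x * g = g * x) : ∃ a b : F, x = a • 1 + b • g := by
  have h00 := congrFun₂ h 0 0
  have h01 := congrFun₂ h 0 1
  have h10 := congrFun₂ h 1 0
  simp only [mul_apply, Fin.sum_univ_two] at h00 h01 h10
  by_cases h1 : g 0 1 = 0
  · by_cases h2 : g 1 0 = 0
    · have h3 : g 0 0 - g 1 1 ≠ 0 := by
        intro h3
        apply hg (g 0 0)
        ext i j
        fin_cases i <;> fin_cases j <;> simp [h1, h2]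
        exact (sub_eq_zero.1 h3).symm
      have e01 : x 0 1 = 0 := by
        have : x 0 1 * (g 0 0 - g 1 1) = 0 := by rw [h1] at h01; linear_combination -h01
        exact (mul_eq_zero.1 this).resolve_right h3
      have e10 : x 1 0 = 0 := by
        have : x 1 0 * (g 0 0 - g 1 1) = 0 := by rw [h2] at h10; linear_combination h10
        exact (mul_eq_zero.1 this).resolve_right h3
      refine ⟨x 0 0 - (x 0 0 - x 1 1) / (g 0 0 - g 1 1) * g 0 0,
        (x 0 0 - x 1 1) / (g 0 0 - g 1 1), ?_⟩
      ext i j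
      fin_cases i <;> fin_cases j <;> simp [h1, h2, e01, e10]
      field_simp
      ring
    · refine ⟨x 0 0 - x 1 0 / g 1 0 * g 0 0, x 1 0 / g 1 0, ?_⟩
      ext i j
      fin_cases i <;> fin_cases j <;> simp
      · field_simp
        linear_combination h00
      · field_simp
      · field_simp
        linear_combination h10
  · refine ⟨x 0 0 - x 0 1 / g 0 1 * g 0 0, x 0 1 / g 0 1, ?_⟩
    ext i j
    fin_cases i <;> fin_cases j <;> simp
    · field_simp
    · field_simp
      linear_combination -h00
    · field_simp
      linear_combination -h01

lemma discr_smul_one_add_smul (a b : F) (g : Matrix (Fin 2) (Fin 2) F) :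
    (a • 1 + b • g).discr = b ^ 2 * g.discr := by
  simp [discr_fin_two, trace_fin_two, det_fin_two]
  ring

/-- In the algebra `F[g]`, with `g` of nonzero discriminant, the elements with the
characteristic polynomial of `g` are `g` and `tr g - g`. -/
lemma eq_or_mul_eq_det_of_commute [NeZero (2 : F)] {x g : Matrix (Fin 2) (Fin 2) F}
    (hg : ∀ c : F, g ≠ c • 1) (hd : g.discr ≠ 0) (h : x * g = g * x)
    (htr : x.trace = g.trace) (hdet : x.det = g.det) : x = g ∨ x * g = g.det • 1 := by
  obtain ⟨a, b, rfl⟩ := exists_eq_smul_add_smul_of_commute hg h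
  have h1 := discr_smul_one_add_smul a b g
  have h2 : (a • 1 + b • g).discr = g.discr := by
    rw [discr_fin_two, discr_fin_two, htr, hdet]
  have hb : b ^ 2 = 1 := mul_right_cancel₀ hd (by rw [← h1, h2, one_mul])
  have htr' : 2 * a + b * (g 0 0 + g 1 1) = g 0 0 + g 1 1 := by
    have := htr
    simp [trace_fin_two] at this
    linear_combination this
  rcases (sq_eq_sq_iff_eq_or_eq_neg (b := (1 : F))).1 (by rw [hb, one_pow]) with rfl | rfl
  · left
    have : a = 0 := (mul_eq_zero.1 (by linear_combination htr' : (2 : F) * a = 0)).resolve_left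
      two_ne_zero
    simp [this]
  · right
    have : a = g 0 0 + g 1 1 := mul_left_cancel₀ (two_ne_zero (α := F)) (by linear_combination htr')
    rw [this]
    ext i j
    fin_cases i <;> fin_cases j <;> simp [mul_apply, det_fin_two] <;> ring

/-- A vector `v ≠ 0` is carried to the first basis vector by a matrix which makes upper triangular
every matrix having `v` as an eigenvector. -/
lemma exists_conj_apply_one_zero_eq_zero {v : Fin 2 → F} (hv : v ≠ 0) :
    ∃ h : GL (Fin 2) F, ∀ y : GL (Fin 2) F, (∃ c : F, (y : Matrix _ _ F) *ᵥ v = c • v) →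
      (h * y * h⁻¹ : GL (Fin 2) F) 1 0 = 0 := by
  obtain ⟨m, hm, hmv⟩ : ∃ m : Matrix (Fin 2) (Fin 2) F, m.det ≠ 0 ∧ m *ᵥ ![1, 0] = v := by
    by_cases h0 : v 0 = 0
    · have h1 : v 1 ≠ 0 := fun h1 => hv (by ext i; fin_cases i <;> assumption)
      exact ⟨!![v 0, 1; v 1, 0], by simpa using h1, by ext i; fin_cases i <;> simp⟩
    · exact ⟨!![v 0, 0; v 1, 1], by simpa using h0, by ext i; fin_cases i <;> simp⟩
  let k : GL (Fin 2) F := GeneralLinearGroup.mkOfDetNeZero m hm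
  refine ⟨k⁻¹, fun y ⟨c, hy⟩ => ?_⟩
  have hk : (k : Matrix _ _ F) *ᵥ ![1, 0] = v := hmv
  have hk' : ((k⁻¹ : GL (Fin 2) F) : Matrix _ _ F) *ᵥ v = ![1, 0] := by
    rw [← hk, mulVec_mulVec, ← Units.val_mul, inv_mul_cancel, Units.val_one, one_mulVec]
  have h1 : ((k⁻¹ * y * k : GL (Fin 2) F) : Matrix _ _ F) *ᵥ ![1, 0] = c • ![1, 0] := by
    rw [Units.val_mul, Units.val_mul, ← mulVec_mulVec, ← mulVec_mulVec, hk, hy, mulVec_smul, hk']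
  have h2 := congrFun h1 1
  rw [inv_inv]
  simpa [mulVec, dotProduct] using h2

lemma exists_smul_eq_of_mulVec_eq {m : Matrix (Fin 2) (Fin 2) F} (hm : m ≠ 1) {v v' : Fin 2 → F}
    (hv0 : v ≠ 0) (hv : m *ᵥ v = v) (hv' : m *ᵥ v' = v') : ∃ c : F, v' = c • v := by
  by_contra! hc
  have hli : LinearIndependent F ![v, v'] := by
    rw [LinearIndependent.pair_iff' hv0]
    exact fun a h => hc a h.symm
  let b := basisOfLinearIndependentOfCardEqFinrank hli (by simp)
  apply hm
  apply Matrix.toLin'.injective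
  refine b.ext fun i => ?_
  fin_cases i <;> simp [b, hv, hv']

end TwoByTwo

/-! ### Matrix groups without nontrivial scalars -/

section NoScalars

variable {F : Type*} [Field F] {H : Subgroup (GL (Fin 2) F)}

/-- The identity is the only scalar matrix of `H`. -/
def HasNoScalars {F : Type*} [CommRing F] (H : Subgroup (GL (Fin 2) F)) : Prop :=
  ∀ x ∈ H, ∀ c : F, (x : Matrix (Fin 2) (Fin 2) F) = c • 1 → x = 1

/-- The matrix of an element of `H`. -/
def toMat : H →* Matrix (Fin 2) (Fin 2) F := (Units.coeHom _).comp H.subtype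

lemma toMat_injective : Function.Injective (toMat (H := H)) :=
  Units.val_injective.comp Subtype.val_injective

lemma toMat_commute {x y : H} (h : x * y = y * x) : toMat x * toMat y = toMat y * toMat x :=
  congrArg toMat h

lemma trace_toMat_conj (w x : H) : (toMat (w * x * w⁻¹)).trace = (toMat x).trace := by
  rw [map_mul, trace_mul_comm, ← map_mul, inv_mul_cancel_left]

lemma det_toMat_conj (w x : H) : (toMat (w * x * w⁻¹)).det = (toMat x).det := by
  rw [map_mul, det_mul_comm, ← map_mul, inv_mul_cancel_left]

namespace HasNoScalars

variable (hH : HasNoScalars H)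
include hH

lemma toMat_ne_smul {x : H} (hx : x ≠ 1) (c : F) : toMat x ≠ c • 1 := fun h =>
  hx (Subtype.ext (hH x x.2 c h))

/-- `H` is commutative-transitive: the elements commuting with `x ≠ 1` lie in `F[x]`. -/
lemma commute_trans {x y z : H} (hx : x ≠ 1) (hy : y * x = x * y) (hz : z * x = x * z) :
    y * z = z * y := by
  obtain ⟨a, b, h1⟩ := exists_eq_smul_add_smul_of_commute (hH.toMat_ne_smul hx) (toMat_commute hy)
  obtain ⟨c, d, h2⟩ := exists_eq_smul_add_smul_of_commute (hH.toMat_ne_smul hx) (toMat_commute hz)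
  apply toMat_injective
  change toMat y * toMat z = toMat z * toMat y
  rw [h1, h2]
  simp [add_mul, mul_add, smul_smul, mul_comm]
  abel

lemma discr_ne_zero_of_commute {x z : H} (hz : z ≠ 1) (hx : x ≠ 1) (hd : (toMat x).discr ≠ 0)
    (h : z * x = x * z) : (toMat z).discr ≠ 0 := by
  obtain ⟨a, b, h1⟩ := exists_eq_smul_add_smul_of_commute (hH.toMat_ne_smul hx) (toMat_commute h)
  rw [h1, discr_smul_one_add_smul]
  refine mul_ne_zero (pow_ne_zero _ ?_) hd
  rintro rfl
  exact hH.toMat_ne_smul hz a (by simpa using h1)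

/-- An element commuting with `x`, with the same characteristic polynomial, is `x` or `x⁻¹`; the
latter requires `det x = 1`, as `x y = det x` is scalar. -/
lemma eq_or_mul_eq_one [NeZero (2 : F)] {x y : H} (hx : x ≠ 1) (hd : (toMat x).discr ≠ 0)
    (h : y * x = x * y) (htr : (toMat y).trace = (toMat x).trace)
    (hdet : (toMat y).det = (toMat x).det) : y = x ∨ y * x = 1 ∧ (toMat x).det = 1 := by
  rcases eq_or_mul_eq_det_of_commute (hH.toMat_ne_smul hx) hd (toMat_commute h) htr hdet with
    h1 | h1
  · exact Or.inl (toMat_injective h1)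
  · have h2 : y * x = 1 := Subtype.ext (hH (y * x : H) (y * x).2 _ h1)
    refine Or.inr ⟨h2, ?_⟩
    have h3 := congrFun₂ ((congrArg toMat h2).symm.trans h1) 0 0
    simpa using h3.symm

lemma conj_eq_or [NeZero (2 : F)] {x : H} (hx : x ≠ 1) (hd : (toMat x).discr ≠ 0) {w : H}
    (h : w * x * w⁻¹ * x = x * (w * x * w⁻¹)) :
    w * x * w⁻¹ = x ∨ w * x * w⁻¹ * x = 1 ∧ (toMat x).det = 1 := by
  exact hH.eq_or_mul_eq_one hx hd h (trace_toMat_conj w x) (det_toMat_conj w x)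

/-- In a finite field with `q` elements, `x ^ q` has the characteristic polynomial of `x`, so that
`x ^ q = x`: the eigenvalues of `x` lie in `F`. -/
lemma pow_card_eq [NeZero (2 : F)] [Finite F] {x : H} (hd : (toMat x).discr ≠ 0)
    (hdet : (toMat x).det ≠ 1) : x ^ Nat.card F = x := by
  have := Fintype.ofFinite F
  have hx : x ≠ 1 := by
    rintro rfl
    exact hdet (by simp)
  have hc : (toMat x ^ Fintype.card F).charpoly = (toMat x).charpoly :=
    FiniteField.Matrix.charpoly_pow_card _
  rw [Nat.card_eq_fintype_card]
  refine (hH.eq_or_mul_eq_one (y := x ^ Fintype.card F) hx hd ?_ ?_ ?_).resolve_right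
    fun h => hdet h.2
  · exact ((Commute.refl x).pow_left _).eq
  · change (toMat x ^ Fintype.card F).trace = _
    rw [trace_eq_neg_charpoly_coeff, hc, ← trace_eq_neg_charpoly_coeff]
  · change (toMat x ^ Fintype.card F).det = _
    rw [det_eq_sign_charpoly_coeff, hc, ← det_eq_sign_charpoly_coeff]

/-- The elements of `H` of discriminant zero are unipotent. -/
lemma of_discr_eq_zero (p : ℕ) [Fact p.Prime] [CharP F p] [NeZero (2 : F)] {x : H}
    (hd : (toMat x).discr = 0) : x ^ p = 1 ∧ (toMat x).trace = 2 ∧ (toMat x).det = 1 := by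
  set a : F := (toMat x).trace / 2 with ha
  set n := toMat x - scalar _ a with hn
  have hn2 : n ^ 2 = 0 := by rw [hn, ha, sub_scalar_sq_eq_discr, hd]; simp
  have hnp : n ^ p = 0 := pow_eq_zero_of_le (Fact.out : p.Prime).two_le hn2
  have hxp : toMat x ^ p = a ^ p • (1 : Matrix (Fin 2) (Fin 2) F) := by
    have h1 : toMat x = scalar _ a + n := by simp [hn]
    rw [h1, add_pow_char_of_commute _ (scalar_commute a (Commute.all a) n), hnp, add_zero,
      ← map_pow, smul_one_eq_diagonal, scalar_apply]
  have hx1 : x ^ p = 1 := Subtype.ext (hH (x ^ p : H) (x ^ p).2 _ hxp)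
  have hap : a ^ p = 1 := by
    have := congrFun₂ (hxp.symm.trans (congrArg toMat hx1)) 0 0
    simpa using this
  have ha1 : a = 1 := by
    have h1 : (a - 1) ^ p = 0 := by rw [sub_pow_char, hap, one_pow, sub_self]
    exact sub_eq_zero.1 (pow_eq_zero_iff (Fact.out : p.Prime).ne_zero |>.1 h1)
  have htr : (toMat x).trace = 2 := by
    rw [ha1, eq_div_iff two_ne_zero, one_mul] at ha
    exact ha.symm
  refine ⟨hx1, htr, ?_⟩
  rw [discr_fin_two, htr] at hd
  have h4 : (2 * 2 : F) ≠ 0 := mul_ne_zero two_ne_zero two_ne_zero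
  exact mul_left_cancel₀ h4 (by linear_combination -hd)

lemma centralizer_comm {g : H} (hg : g ≠ 1) (x : H) (hx : x ∈ Subgroup.centralizer {g}) (y : H)
    (hy : y ∈ Subgroup.centralizer {g}) : x * y = y * x :=
  hH.commute_trans hg (Subgroup.mem_centralizer_singleton_iff.1 hx)
    (Subgroup.mem_centralizer_singleton_iff.1 hy)

lemma isIsolated_centralizer [NeZero (2 : F)] {g : H} (hd : (toMat g).discr ≠ 0)
    (hdet : (toMat g).det ≠ 1) : IsIsolated (Subgroup.centralizer {g}) := by
  have hg : g ≠ 1 := by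
    rintro rfl
    exact hdet (by simp)
  intro x hx hx1 w hw
  rw [Subgroup.mem_centralizer_singleton_iff] at hx hw ⊢
  -- `x` commutes both with `g` and with `w g w⁻¹`
  have h1 : w * g * w⁻¹ * x = x * (w * g * w⁻¹) := by
    calc w * g * w⁻¹ * x = w * (g * (w⁻¹ * x * w)) * w⁻¹ := by group
      _ = x * (w * g * w⁻¹) := by rw [← hw]; group
  have h2 := (hH.conj_eq_or hg hd (hH.commute_trans hx1 h1 hx.symm)).resolve_right
    fun h => hdet h.2
  exact mul_inv_eq_iff_eq_mul.1 h2

end HasNoScalars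

end NoScalars

/-! ### The Frobenius kernel and the centralizer of an element of determinant `2` -/

section Kernel

variable {F : Type*} [Field F] {H : Subgroup (GL (Fin 2) F)}

lemma discr_toMat_one : (toMat (1 : H)).discr = 0 := by
  simp [discr_fin_two]
  norm_num

namespace HasNoScalars

variable (hH : HasNoScalars H)
include hH

/-- The centralizer of a nontrivial element of the Frobenius kernel lies in the kernel. -/
lemma mem_of_commute [Finite H] {g : H} {X : Subgroup H} [X.Normal]
    (hinf : X ⊓ Subgroup.centralizer {g} = ⊥) (hsup : X ⊔ Subgroup.centralizer {g} = ⊤)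
    {z : H} (hz : z ∈ X) (hz1 : z ≠ 1) {y : H} (h : y * z = z * y) : y ∈ X := by
  have hfree : ∀ c ∈ Subgroup.centralizer {g}, c ≠ 1 → ∀ x ∈ X, x * c = c * x → x = 1 := by
    intro c hc hc1 x hx hxc
    have h1 := hH.commute_trans hc1 hxc (Subgroup.mem_centralizer_singleton_iff.1 hc).symm
    exact Subgroup.mem_bot.1 (hinf ▸ ⟨hx, Subgroup.mem_centralizer_singleton_iff.2 h1⟩)
  by_contra hy
  obtain ⟨c, hc, hc1, w, hw⟩ := exists_conj_mem_of_notMem hsup hfree hy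
  apply hz1
  have h1 : w⁻¹ * z * w = 1 := by
    refine hfree c hc hc1 _ ?_ ?_
    · simpa using Subgroup.Normal.conj_mem inferInstance z hz w⁻¹
    · rw [← hw]
      calc w⁻¹ * z * w * (w⁻¹ * y * w) = w⁻¹ * (z * y) * w := by group
        _ = w⁻¹ * y * w * (w⁻¹ * z * w) := by rw [← h]; group
  calc z = w * (w⁻¹ * z * w) * w⁻¹ := by group
    _ = 1 := by rw [h1]; group

/-- The Frobenius kernel is unipotent. Otherwise a Sylow subgroup of it for a prime `l` has a
central element `z` of nonzero discriminant. By the Frattini argument `g = w x` where `w`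
normalizes that Sylow subgroup and `x` is in the kernel; so `w z w⁻¹` commutes with `z`, hence
equals `z` or `z⁻¹`, and `w ^ 2` centralizes `z`. Thus `w ^ 2` and `g ^ 2` are in the kernel,
and `g ^ 2 = 1`. -/
lemma discr_eq_zero_of_mem_kernel [NeZero (2 : F)] [Finite H] {g : H}
    (hdet : (toMat g).det ^ 2 ≠ 1) {X : Subgroup H} [X.Normal]
    (hinf : X ⊓ Subgroup.centralizer {g} = ⊥) (hsup : X ⊔ Subgroup.centralizer {g} = ⊤)
    {x : H} (hx : x ∈ X) : (toMat x).discr = 0 := by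
  have hg : g ≠ 1 := by
    rintro rfl
    exact hdet (by simp)
  by_contra hd
  have hx1 : x ≠ 1 := by
    rintro rfl
    exact hd discr_toMat_one
  obtain ⟨l, hl, k, hk⟩ := Nat.exists_prime_and_dvd (mt orderOf_eq_one_iff.1 hx1)
  have : Fact l.Prime := ⟨hl⟩
  have hk0 : k ≠ 0 := by
    rintro rfl
    exact (orderOf_pos x).ne' (by simpa using hk)
  let a : X := ⟨x ^ k, X.pow_mem hx k⟩
  have ha : orderOf a = l := by
    rw [← Subgroup.orderOf_coe]
    exact (orderOf_pow_of_dvd hk0 (hk ▸ dvd_mul_left k l)).trans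
      (by rw [hk, Nat.mul_div_cancel _ (Nat.pos_of_ne_zero hk0)])
  have ha1 : a ≠ 1 := by
    intro h
    rw [h, orderOf_one] at ha
    exact hl.one_lt.ne ha
  obtain ⟨L, hL⟩ := (IsPGroup.of_card (n := 1) (by rw [Nat.card_zpowers, ha, pow_one]) :
    IsPGroup l (Subgroup.zpowers a)).exists_le_sylow
  have haL : a ∈ L := hL (Subgroup.mem_zpowers a)
  have : Nontrivial L := ⟨⟨⟨a, haL⟩, 1, fun h => ha1 (congrArg Subtype.val h)⟩⟩
  have := L.isPGroup'.center_nontrivial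
  obtain ⟨⟨⟨z, hzL⟩, hzc⟩, hz1⟩ := exists_ne (1 : Subgroup.center L)
  have hz1' : (z : H) ≠ 1 := fun h => hz1 (Subtype.ext (Subtype.ext (Subtype.ext h)))
  have hzcomm : ∀ b ∈ L, (b : H) * z = z * b := fun b hb =>
    congrArg (fun t : L => ((t : X) : H)) (Subgroup.mem_center_iff.1 hzc ⟨b, hb⟩)
  have hda : (toMat (a : H)).discr ≠ 0 :=
    hH.discr_ne_zero_of_commute (fun h => ha1 (Subtype.ext h)) hx1 hd
      ((Commute.refl x).pow_left k).eq
  have hdz : (toMat (z : H)).discr ≠ 0 :=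
    hH.discr_ne_zero_of_commute hz1' (fun h => ha1 (Subtype.ext h)) hda (hzcomm a haL).symm
  have hgt : g ∈ Subgroup.normalizer ((L : Subgroup X).map X.subtype : Set H) ⊔ X := by
    rw [L.normalizer_sup_eq_top]
    exact Subgroup.mem_top g
  obtain ⟨w, hw, y, hy, hwy⟩ := Subgroup.mem_sup_of_normal_right.1 hgt
  obtain ⟨b, hb, hbw⟩ := (Subgroup.mem_normalizer_iff.1 hw z).1 ⟨z, hzL, rfl⟩
  have hbw' : (b : H) = w * z * w⁻¹ := hbw
  have hww : w ^ 2 * z = z * w ^ 2 := by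
    have h1 := hzcomm b hb
    rw [hbw'] at h1
    have h3 : w * (w * z * w⁻¹) * w⁻¹ = z := by
      rcases hH.conj_eq_or hz1' hdz h1 with h2 | ⟨h2, -⟩
      · rw [h2, h2]
      · rw [mul_eq_one_iff_eq_inv] at h2
        rw [h2, show w * (z : H)⁻¹ * w⁻¹ = (w * z * w⁻¹)⁻¹ by group, h2, inv_inv]
    calc w ^ 2 * z = w * (w * z * w⁻¹) * w⁻¹ * w ^ 2 := by
          simp [pow_two, mul_assoc]
      _ = z * w ^ 2 := by rw [h3]
  have hwX : w ^ 2 ∈ X := hH.mem_of_commute hinf hsup z.2 hz1' hww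
  have hgX : g ^ 2 ∈ X := by
    rw [← QuotientGroup.eq_one_iff] at hwX hy ⊢
    rw [← hwy, QuotientGroup.mk_pow, QuotientGroup.mk_mul, hy, mul_one, ← QuotientGroup.mk_pow, hwX]
  have hg2 : g ^ 2 = 1 := Subgroup.mem_bot.1 (hinf ▸ ⟨hgX,
    Subgroup.mem_centralizer_singleton_iff.2 ((Commute.refl g).pow_left 2).eq⟩)
  apply hdet
  rw [← det_pow, ← map_pow, hg2, map_one, det_one]

/-- An element whose determinant is not `1` and whose discriminant is not zero has an eigenvector
over the finite field `F`, as it is annihilated by `X ^ q - X`. -/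
lemma exists_eigenvector [NeZero (2 : F)] [Finite F] {g : H} (hd : (toMat g).discr ≠ 0)
    (hdet : (toMat g).det ≠ 1) : ∃ v : Fin 2 → F, v ≠ 0 ∧ ∃ c : F, toMat g *ᵥ v = c • v := by
  have := Fintype.ofFinite F
  have h1 : toMat g ^ Fintype.card F = toMat g := by
    rw [← Nat.card_eq_fintype_card, ← map_pow, hH.pow_card_eq hd hdet]
  have hdvd : minpoly F (toLin' (toMat g)) ∣ Polynomial.X ^ Fintype.card F - Polynomial.X := by
    rw [Matrix.minpoly_toLin']
    exact minpoly.dvd _ _ (by simp [h1])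
  have hsplit : (Polynomial.X ^ Fintype.card F - Polynomial.X : Polynomial F).Splits := by
    rw [Polynomial.splits_iff_card_roots, FiniteField.roots_X_pow_card_sub_X,
      FiniteField.X_pow_card_sub_X_natDegree_eq _ Fintype.one_lt_card]
    rfl
  obtain ⟨c, hc⟩ := (hsplit.of_dvd
    (FiniteField.X_pow_card_sub_X_ne_zero _ Fintype.one_lt_card) hdvd).exists_eval_eq_zero
    (minpoly.degree_pos (Algebra.IsIntegral.isIntegral _)).ne'
  obtain ⟨v, hv⟩ := (Module.End.hasEigenvalue_of_isRoot hc).exists_hasEigenvector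
  exact ⟨v, hv.2, c, by simpa using hv.apply_eq_smul⟩

/-- The elements of `H` have a common eigenvector: one of `g` if the Frobenius kernel `X` is trivial, and otherwise
a vector fixed by a nontrivial central element `u` of `X`, since the conjugates of `u` commute
with `u` and so fix the same line. -/
lemma exists_conj_upperTriangular (p : ℕ) [Fact p.Prime] [CharP F p] [NeZero (2 : F)] [Finite F]
    {g : H} (hd : (toMat g).discr ≠ 0) (hdet : (toMat g).det ≠ 1) {X : Subgroup H} [X.Normal]
    (hsup : X ⊔ Subgroup.centralizer {g} = ⊤) (hX : ∀ x ∈ X, (toMat x).discr = 0)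
    (hXp : IsPGroup p X) :
    ∃ h : GL (Fin 2) F, ∀ y ∈ H, (h * y * h⁻¹ : GL (Fin 2) F) 1 0 = 0 := by
  suffices ∃ v : Fin 2 → F, v ≠ 0 ∧ ∀ y : H, ∃ c : F, toMat y *ᵥ v = c • v by
    obtain ⟨v, hv, hc⟩ := this
    obtain ⟨h, hh⟩ := exists_conj_apply_one_zero_eq_zero hv
    exact ⟨h, fun y hy => hh y (hc ⟨y, hy⟩)⟩
  rcases X.bot_or_nontrivial with rfl | hnt
  · have hg : g ≠ 1 := by
      rintro rfl
      exact hdet (by simp)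
    obtain ⟨v, hv, c, hc⟩ := hH.exists_eigenvector hd hdet
    refine ⟨v, hv, fun y => ?_⟩
    have hy : y ∈ Subgroup.centralizer {g} := by
      rw [bot_sup_eq] at hsup
      exact hsup ▸ Subgroup.mem_top y
    obtain ⟨a, b, hab⟩ := exists_eq_smul_add_smul_of_commute (hH.toMat_ne_smul hg)
      (toMat_commute (Subgroup.mem_centralizer_singleton_iff.1 hy))
    refine ⟨a + b * c, ?_⟩
    rw [hab, add_mulVec, smul_mulVec, smul_mulVec, one_mulVec, hc, add_smul, smul_smul]
  · have := hXp.center_nontrivial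
    obtain ⟨⟨u, huc⟩, hu1⟩ := exists_ne (1 : Subgroup.center X)
    have hu1' : (u : H) ≠ 1 := fun h => hu1 (Subtype.ext (Subtype.ext h))
    obtain ⟨-, htr, hdu⟩ := hH.of_discr_eq_zero p (hX u u.2)
    obtain ⟨v, hv, huv⟩ := (Matrix.exists_mulVec_eq_zero_iff (M := toMat (u : H) - 1)).2 (by
      rw [trace_fin_two] at htr
      rw [det_fin_two] at hdu ⊢
      simp
      linear_combination hdu - htr)
    have huv' : toMat (u : H) *ᵥ v = v := by
      rwa [sub_mulVec, one_mulVec, sub_eq_zero] at huv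
    refine ⟨v, hv, fun w => ?_⟩
    have hwX : w⁻¹ * u * w ∈ X := by
      simpa using Subgroup.Normal.conj_mem inferInstance (u : H) u.2 w⁻¹
    have hcomm : (w⁻¹ * (u : H) * w) * (u : H) = (u : H) * (w⁻¹ * (u : H) * w) :=
      congrArg Subtype.val (Subgroup.mem_center_iff.1 huc ⟨_, hwX⟩)
    obtain ⟨a, b, hab⟩ := exists_eq_smul_add_smul_of_commute (hH.toMat_ne_smul hu1')
      (toMat_commute hcomm)
    have hab1 : a + b = 1 := by
      have h1 := (hH.of_discr_eq_zero p (hX _ hwX)).2.1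
      rw [hab, trace_add, trace_smul, trace_smul, htr, trace_one] at h1
      simp at h1
      exact mul_right_cancel₀ (two_ne_zero (α := F)) (by linear_combination h1)
    have h2 : toMat (w⁻¹ * (u : H) * w) *ᵥ v = v := by
      rw [hab, add_mulVec, smul_mulVec, smul_mulVec, one_mulVec, huv', ← add_smul, hab1, one_smul]
    have h3 : toMat (u : H) *ᵥ (toMat w *ᵥ v) = toMat w *ᵥ v := by
      conv_rhs => rw [← h2]
      rw [mulVec_mulVec, mulVec_mulVec, ← map_mul, ← map_mul]
      congr 2
      group
    exact exists_smul_eq_of_mulVec_eq (fun h => hu1' (toMat_injective (by rw [h, map_one]))) hv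
      huv' h3

/-- The ratio of the two eigenvalues embeds the centralizer of `g` into the multiplicative group
of `F`. -/
lemma isCyclic_centralizer [Finite H] {g : H}
    (hg : g ≠ 1) (hd : (toMat g).discr ≠ 0) {h : GL (Fin 2) F}
    (hh : ∀ y ∈ H, (h * y * h⁻¹ : GL (Fin 2) F) 1 0 = 0) :
    IsCyclic (Subgroup.centralizer {g}) := by
  let A : H →* Matrix (Fin 2) (Fin 2) F :=
    (Units.coeHom _).comp ((MulAut.conj h).toMonoidHom.comp H.subtype)
  have hA10 : ∀ y : H, A y 1 0 = 0 := fun y => hh y y.2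
  have hAdet : ∀ y : H, A y 0 0 * A y 1 1 = (A y).det := fun y => by
    rw [det_fin_two, hA10]; ring
  have hA11 : ∀ y : H, A y 1 1 ≠ 0 := fun y h0 => by
    have h1 : (A y).det ≠ 0 :=
      (Matrix.GeneralLinearGroup.det (MulAut.conj h (y : GL (Fin 2) F))).ne_zero
    exact h1 (by rw [← hAdet, h0, mul_zero])
  have hAd : ∀ y : H, (A y).discr = (toMat y).discr := fun y => by
    change ((h : Matrix _ _ F) * toMat y * (↑h⁻¹ : Matrix _ _ F)).discr = _
    rw [Matrix.coe_units_inv, discr_conj]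
  let f : H →* F :=
    { toFun y := A y 0 0 / A y 1 1
      map_one' := by simp
      map_mul' x y := by
        have h1 : A (x * y) 0 0 = A x 0 0 * A y 0 0 := by
          simp [mul_apply, hA10]
        have h2 : A (x * y) 1 1 = A x 1 1 * A y 1 1 := by
          simp [mul_apply, hA10]
        rw [h1, h2, mul_div_mul_comm] }
  refine isCyclic_of_injective_ringHom (f.comp (Subgroup.centralizer {g}).subtype) ?_
  refine (injective_iff_map_eq_one _).2 fun y hy => ?_
  by_contra hy1
  have hy1' : (y : H) ≠ 1 := fun h => hy1 (Subtype.ext h)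
  refine hH.discr_ne_zero_of_commute hy1' hg hd
    (Subgroup.mem_centralizer_singleton_iff.1 y.2) ?_
  have h1 : A (y : H) 0 0 = A (y : H) 1 1 := (div_eq_one_iff_eq (hA11 y)).1 hy
  rw [← hAd, discr_fin_two, trace_fin_two, det_fin_two, hA10, h1]
  ring

/-- The structure of `H`: it is upper triangular in some basis, and is generated by a normal
`p`-group and a cyclic complement, the centralizer of an element of determinant `2`. That `2 ≠ 0`,
`2 ≠ 1` and `2 ^ 2 ≠ 1` in `F` is where `p ≥ 5` is needed. -/
theorem exists_normal_sup_zpowers (p : ℕ) [Fact p.Prime] (hp5 : 5 ≤ p) [CharP F p] [Finite F]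
    (hdet : ∀ u : Fˣ, (∃ g ∈ H, Matrix.GeneralLinearGroup.det g = u) ↔ ∃ m : ℤ, (u : F) = m) :
    ∃ h : GL (Fin 2) F, (∀ y ∈ H, (h * y * h⁻¹ : GL (Fin 2) F) 1 0 = 0) ∧
      ∃ (X : Subgroup H) (y : H), X.Normal ∧ IsPGroup p X ∧ X ⊔ Subgroup.zpowers y = ⊤ ∧
        y ^ (Nat.card F - 1) = 1 ∧
        orderOf (Matrix.GeneralLinearGroup.det (y : GL (Fin 2) F)) = p - 1 := by
  have hnat : ∀ n : ℕ, 0 < n → n < 5 → (n : F) ≠ 0 := fun n h0 h5 h => by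
    have := Nat.le_of_dvd h0 ((CharP.cast_eq_zero_iff F p n).1 h)
    omega
  have h2 : (2 : F) ≠ 0 := by simpa using hnat 2 (by norm_num) (by norm_num)
  have h3 : (3 : F) ≠ 0 := by simpa using hnat 3 (by norm_num) (by norm_num)
  have : NeZero (2 : F) := ⟨h2⟩
  obtain ⟨g', hgH, hg2⟩ := (hdet (Units.mk0 2 h2)).2 ⟨2, by simp⟩
  let g : H := ⟨g', hgH⟩
  have hgdet : (toMat g).det = 2 := congrArg Units.val hg2
  have hdet1 : (toMat g).det ≠ 1 := fun h => by
    rw [hgdet] at h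
    exact one_ne_zero (α := F) (by linear_combination h)
  have hdet2 : (toMat g).det ^ 2 ≠ 1 := fun h => by
    rw [hgdet] at h
    exact h3 (by linear_combination h)
  have hg1 : g ≠ 1 := fun h => hdet1 (by simp [h])
  have hd : (toMat g).discr ≠ 0 := fun h => hdet1 (hH.of_discr_eq_zero p h).2.2
  obtain ⟨X, hXn, hinf, hsup⟩ :=
    (hH.isIsolated_centralizer hd hdet1).exists_normal_complement (hH.centralizer_comm hg1)
  have hX : ∀ x ∈ X, (toMat x).discr = 0 := fun x hx =>
    hH.discr_eq_zero_of_mem_kernel hdet2 hinf hsup hx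
  have hXp : IsPGroup p X := fun x =>
    ⟨1, Subtype.ext (by simpa using (hH.of_discr_eq_zero p (hX x x.2)).1)⟩
  obtain ⟨h, hh⟩ := hH.exists_conj_upperTriangular p hd hdet1 hsup hX hXp
  obtain ⟨y, hy⟩ := (hH.isCyclic_centralizer hg1 hd hh).exists_generator
  have hzp : Subgroup.zpowers (y : H) = Subgroup.centralizer {g} := by
    refine le_antisymm (Subgroup.zpowers_le.2 y.2) fun c hc => ?_
    obtain ⟨n, hn⟩ := Subgroup.mem_zpowers_iff.1 (hy ⟨c, hc⟩)
    exact Subgroup.mem_zpowers_iff.2 ⟨n, by simpa using congrArg Subtype.val hn⟩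
  let D : H →* Fˣ := Matrix.GeneralLinearGroup.det.comp H.subtype
  have hDX : X.map D = ⊥ := by
    rw [Subgroup.map_eq_bot_iff]
    exact fun x hx => Units.ext (hH.of_discr_eq_zero p (hX x hx)).2.2
  have hDy : Subgroup.zpowers (D y) = D.range := by
    rw [MonoidHom.range_eq_map, ← hsup, Subgroup.map_sup, hDX, bot_sup_eq,
      ← MonoidHom.map_zpowers]
    exact congrArg (Subgroup.map D) hzp
  have hcast : D.range = (Units.map (ZMod.castHom (dvd_refl p) F).toMonoidHom).range := by
    ext u
    have h1 : u ∈ D.range ↔ ∃ m : ℤ, (u : F) = m := by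
      rw [← hdet u]
      exact ⟨fun ⟨x, hx⟩ => ⟨x, x.2, hx⟩, fun ⟨x, hxH, hx⟩ => ⟨⟨x, hxH⟩, hx⟩⟩
    rw [h1]
    constructor
    · rintro ⟨m, hm⟩
      have hm0 : (m : ZMod p) ≠ 0 := fun h0 => u.ne_zero (by
        rw [hm, ← map_intCast (ZMod.castHom (dvd_refl p) F), h0, map_zero])
      exact ⟨Units.mk0 _ hm0, Units.ext (by simp [hm])⟩
    · rintro ⟨a, rfl⟩
      obtain ⟨m, hm⟩ := ZMod.intCast_surjective (a : ZMod p)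
      exact ⟨m, by simp [← hm]⟩
  have hord : orderOf (D y) = p - 1 := by
    rw [← Nat.card_zpowers, hDy, hcast, ← ZMod.card_units p, ← Nat.card_eq_fintype_card]
    exact (Nat.card_congr (MonoidHom.ofInjective
      (Units.map_injective (ZMod.castHom (dvd_refl p) F).injective)).toEquiv).symm
  have hdy : (toMat (y : H)).det ≠ 1 := fun h => by
    have : D y = 1 := Units.ext h
    rw [this, orderOf_one] at hord
    omega
  have hy1 : (y : H) ≠ 1 := fun h => hdy (by simp [h])
  refine ⟨h, hh, X, y, hXn, hXp, by rw [hzp, hsup], ?_, hord⟩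
  have hpow := hH.pow_card_eq (hH.discr_ne_zero_of_commute hy1 hg1 hd
    (Subgroup.mem_centralizer_singleton_iff.1 y.2)) hdy
  rw [← Nat.sub_add_cancel (Finite.card_pos : 0 < Nat.card F), pow_succ] at hpow
  exact mul_eq_right.1 hpow

end HasNoScalars

end Kernel

/-! ### Finiteness of the residue field -/

section ResidueField

open Polynomial

/-- An integral relation of degree at most `[E : ℚ]` satisfied by `r`, not divisible by `p`. -/
lemma exists_int_relation {E : Type*} [Field E] [NumberField E] {p : ℕ} (hp : p.Prime) (r : E) :
    ∃ g : Fin (Module.finrank ℚ E + 1) → ℤ, (∃ i, ¬ (p : ℤ) ∣ g i) ∧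
      ∑ i, (g i : E) * r ^ (i : ℕ) = 0 := by
  have hdep : ¬ LinearIndependent ℤ (fun i : Fin (Module.finrank ℚ E + 1) => r ^ (i : ℕ)) := by
    rw [LinearIndependent.iff_fractionRing (R := ℤ) (K := ℚ)]
    intro h
    simpa using h.fintype_card_le_finrank
  obtain ⟨c, hc, i, hi⟩ := Fintype.not_linearIndependent_iff.1 hdep
  obtain ⟨g, hg, hg1⟩ := Finset.extract_gcd c (Finset.univ_nonempty)
  refine ⟨g, ?_, ?_⟩
  · by_contra! h
    have h1 : (p : ℤ) ∣ Finset.univ.gcd g := Finset.dvd_gcd fun i _ => h i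
    rw [hg1] at h1
    exact hp.one_lt.ne' (by exact_mod_cast Int.eq_one_of_dvd_one (by positivity) h1)
  · have h0 : ((Finset.univ.gcd c : ℤ) : E) ≠ 0 := by
      rw [Int.cast_ne_zero]
      exact fun h => hi (Finset.gcd_eq_zero_iff.1 h i (Finset.mem_univ i))
    refine (mul_eq_zero.1 ?_).resolve_left h0
    rw [← hc, Finset.mul_sum]
    refine Finset.sum_congr rfl fun j _ => ?_
    rw [hg j (Finset.mem_univ j), zsmul_eq_mul, Int.cast_mul, mul_assoc]

/-- The residue rings of a subring of a number field at primes above `p` are finite: their elements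
are roots of nonzero polynomials of bounded degree over `𝔽_p`. -/
lemma finite_quotient {E : Type*} [Field E] [NumberField E] {p : ℕ} (hp : p.Prime)
    (R : Subring E) (P : Ideal R) [P.IsPrime] (hpP : (p : R) ∈ P) : Finite (R ⧸ P) := by
  classical
  have : Fact p.Prime := ⟨hp⟩
  have hchar : CharP (R ⧸ P) p := (CharP.charP_iff_prime_eq_zero hp).2 (by
    rw [← map_natCast (Ideal.Quotient.mk P)]
    exact Ideal.Quotient.eq_zero_iff_mem.2 hpP)
  let f : (Fin (Module.finrank ℚ E + 1) → ZMod p) → (R ⧸ P)[X] := fun v =>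
    ∑ i : Fin (Module.finrank ℚ E + 1), monomial (i : ℕ) (ZMod.castHom (dvd_refl p) (R ⧸ P) (v i))
  have hf : ∀ v (i : Fin (Module.finrank ℚ E + 1)), (f v).coeff (i : ℕ) =
      ZMod.castHom (dvd_refl p) (R ⧸ P) (v i) := fun v i => by
    simp only [f, finsetSum_coeff, coeff_monomial, Fin.val_inj]
    simp
  have hfin : (⋃ v, {x | f v ≠ 0 ∧ (f v).eval x = 0}).Finite := by
    refine Set.finite_iUnion fun v => ?_
    by_cases h : f v = 0
    · simp [h]
    · exact (f v).roots.toFinset.finite_toSet.subset fun x hx => by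
        simpa [h] using hx.2
  refine Set.finite_univ_iff.1 (hfin.subset fun x _ => ?_)
  obtain ⟨r, rfl⟩ := Ideal.Quotient.mk_surjective x
  obtain ⟨g, ⟨i, hi⟩, hg⟩ := exists_int_relation hp (r : E)
  refine Set.mem_iUnion.2 ⟨fun i => (g i : ZMod p), fun h0 => ?_, ?_⟩
  · have h1 := hf (fun i => (g i : ZMod p)) i
    rw [h0, coeff_zero, eq_comm, map_eq_zero_iff _ (ZMod.castHom_injective _)] at h1
    exact hi ((ZMod.intCast_zmod_eq_zero_iff_dvd _ _).1 h1)
  · have h1 : ∑ i, (g i : R) * r ^ (i : ℕ) = 0 := Subtype.ext (by push_cast; exact hg)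
    have h2 := congrArg (Ideal.Quotient.mk P) h1
    simp only [map_sum, map_mul, map_pow, map_intCast, map_zero] at h2
    simpa [f, eval_finsetSum] using h2

end ResidueField

/-! ### Vanishing of cohomology in the presence of a central scalar -/

section Cohomology

open groupCohomology in
/-- Sah's lemma: if `z` is central in `Γ` and `z - 1` has an equivariant left inverse on `M`, then
`H¹(Γ, M) = 0`. -/
lemma H1loc_eq_bot_of_central {Γ M : Type} [Group Γ] [AddCommGroup M] [DistribMulAction Γ M]
    (z : Γ) (hz : ∀ γ, z * γ = γ * z) (e : M →+ M) (he : ∀ (γ : Γ) (m : M), e (γ • m) = γ • e m)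
    (hez : ∀ m : M, e (z • m - m) = m) : H1loc Γ M = ⊥ := by
  rw [eq_bot_iff]
  rintro _ ⟨Z, -, rfl⟩
  let f : Γ → M := fun γ => Z γ
  have hf : ∀ γ δ : Γ, f (γ * δ) = γ • f δ + f γ := (mem_cocycles₁_iff _).1 Z.2
  have h : ∀ γ, γ • e (f z) - e (f z) = f γ := fun γ => by
    have h1 : z • f γ - f γ = γ • f z - f z := by
      rw [sub_eq_sub_iff_add_eq_add, ← hf, hz, hf]
    rw [← he, ← map_sub, ← h1, hez]
  exact (Submodule.mem_bot ℤ).2 ((H1π_eq_zero_iff Z).2 ⟨e (f z), funext h⟩)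

/-- If `p` and `t - c` are nilpotent then `t` and `c` have a common `p`-power. -/
lemma exists_pow_sub_pow_eq {R : Type*} [CommRing R] {p : ℕ} (hp : p.Prime) (n : ℕ) (t c : R) :
    ∃ s r : R, t ^ p ^ (n + n) - c ^ p ^ (n + n) = s * (t - c) ^ n + r * (p : R) ^ n := by
  obtain ⟨u, hu⟩ := exists_add_pow_prime_pow_eq hp (t - c) c n
  rw [sub_add_cancel] at hu
  obtain ⟨r, hr⟩ := dvd_sub_pow_of_dvd_sub (R := R) (p := p) (a := t ^ p ^ n - (t - c) ^ p ^ n)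
    (b := c ^ p ^ n) ⟨(t - c) * c * u, by linear_combination hu⟩ n
  obtain ⟨v, hv⟩ := sub_dvd_pow_sub_pow (t ^ p ^ n) (t ^ p ^ n - (t - c) ^ p ^ n) (p ^ n)
  obtain ⟨k, hk⟩ := Nat.exists_eq_add_of_le (Nat.lt_pow_self (n := n) hp.one_lt).le
  refine ⟨(t - c) ^ k * v, p * r, ?_⟩
  have h1 : (t - c) ^ p ^ n = (t - c) ^ n * (t - c) ^ k := by rw [← pow_add, ← hk]
  rw [sub_sub_cancel, h1] at hv
  rw [h1] at hr
  rw [pow_add, pow_mul, pow_mul]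
  linear_combination hv + hr

end Cohomology

/-! ### The action of Galois on torsion points -/

open AbelianVariety Polynomial

namespace Embedding

variable {k : Type u} [Field k] {A : AbelianVariety k} {E : Type v} [Field E] [NumberField E]
  (S : Embedding A E)

/-- The action of a Galois automorphism on `A(k̄)`, as an `R`-linear map. -/
noncomputable def galEnd (σ : AbsGal k) : Module.End S.order S.Points where
  toFun x := σ • x
  map_add' := smul_add σ
  map_smul' r x := smul_comm σ r x

lemma galEnd_pow_apply (σ : AbsGal k) (n : ℕ) (x : S.Points) :
    (S.galEnd σ ^ n) x = σ ^ n • x := by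
  induction n generalizing x with
  | zero => simp
  | succ n ih => rw [pow_succ, Module.End.mul_apply, ih, pow_succ, mul_smul]; rfl

/-- If `σ` acts on `A[P]` as `c` then `σ - c` maps `A[P ^ (i + 1)]` to `A[P ^ i]`. -/
lemma sub_pow_apply_eq_zero {P : Ideal S.order} {σ : AbsGal k} {c : S.order}
    (hc : ∀ x ∈ S.torsion P, σ • x = c • x) (i : ℕ) {x : S.Points} (hx : x ∈ S.torsion (P ^ i)) :
    ((S.galEnd σ - algebraMap S.order _ c) ^ i) x = 0 := by
  induction i generalizing x with
  | zero =>
    rw [Submodule.mem_torsionBySet_iff] at hx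
    simpa using hx ⟨1, by simp⟩
  | succ i ih =>
    rw [pow_succ, Module.End.mul_apply]
    refine ih ((Submodule.mem_torsionBySet_iff _ _).2 fun a => ?_)
    have hax : (a : S.order) • x ∈ S.torsion P := by
      refine (Submodule.mem_torsionBySet_iff _ _).2 fun b => ?_
      have h := (Submodule.mem_torsionBySet_iff _ _).1 hx
        ⟨(b : S.order) * a, by rw [pow_succ']; exact Ideal.mul_mem_mul b.2 a.2⟩
      rw [← h, smul_smul]
    have h1 : (S.galEnd σ) ((a : S.order) • x) = c • (a : S.order) • x := hc _ hax
    rw [← map_smul, LinearMap.sub_apply, h1, Module.algebraMap_end_apply, sub_self]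

/-- If `σ` acts on `A[P]` as `c` then a power of `σ` acts on `A[P ^ n]` as a power of `c`. -/
lemma pow_smul_eq_pow_smul {P : Ideal S.order} {p : ℕ} (hp : p.Prime) (hpP : (p : S.order) ∈ P)
    {σ : AbsGal k} {c : S.order} (hc : ∀ x ∈ S.torsion P, σ • x = c • x) (n : ℕ) {x : S.Points}
    (hx : x ∈ S.torsion (P ^ n)) : σ ^ p ^ (n + n) • x = c ^ p ^ (n + n) • x := by
  obtain ⟨s, r, h⟩ := exists_pow_sub_pow_eq hp n (X : (S.order)[X]) (C c)
  have h1 := congrArg (fun f : (S.order)[X] => aeval (S.galEnd σ) f x) h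
  have hpx : ((p : Module.End S.order S.Points) ^ n) x = 0 := by
    have h2 := (Submodule.mem_torsionBySet_iff _ _).1 hx ⟨(p : S.order) ^ n, Ideal.pow_mem_pow hpP n⟩
    rw [← map_natCast (algebraMap S.order (Module.End S.order S.Points)), ← map_pow]
    exact h2
  simp only [map_sub, map_pow, aeval_X, aeval_C, map_add, map_mul, map_natCast,
    LinearMap.sub_apply, LinearMap.add_apply, Module.End.mul_apply] at h1
  rw [S.sub_pow_apply_eq_zero hc n hx, hpx, map_zero, map_zero, add_zero, sub_eq_zero,
    galEnd_pow_apply, ← map_pow, Module.algebraMap_end_apply] at h1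
  exact h1

end Embedding

/-! ### Scalars in the image of Galois -/

/-- The cohomology of a group of linear automorphisms containing a scalar `r` with `r - 1`
invertible vanishes. -/
lemma H1loc_eq_bot_of_scalar {R M : Type} [CommRing R] [AddCommGroup M] [Module R M]
    {Γ : Subgroup (LinearMap.GeneralLinearGroup R M)} {z : LinearMap.GeneralLinearGroup R M}
    (hzΓ : z ∈ Γ) {a r : R} (hz : ∀ y : M, z • y = r • y) (ha : a * (r - 1) = 1) :
    H1loc Γ M = ⊥ := by
  have hlin : ∀ (γ : Γ) (s : R) (y : M), γ • s • y = s • γ • y := fun γ s y =>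
    ((γ : LinearMap.GeneralLinearGroup R M) : M →ₗ[R] M).map_smul s y
  have hz' : ∀ y : M, (⟨z, hzΓ⟩ : Γ) • y = r • y := hz
  refine H1loc_eq_bot_of_central ⟨z, hzΓ⟩ (fun γ => ?_) (DistribSMul.toAddMonoidHom _ a)
    (fun γ y => (hlin γ a y).symm) fun y => ?_
  · refine Subtype.ext (Units.ext (LinearMap.ext fun y => ?_))
    change (⟨z, hzΓ⟩ : Γ) • γ • y = γ • (⟨z, hzΓ⟩ : Γ) • y
    rw [hz', hz', hlin]
  · change a • ((⟨z, hzΓ⟩ : Γ) • y - y) = y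
    nth_rewrite 2 [← one_smul R y]
    rw [hz', ← sub_smul, smul_smul, ha, one_smul]

/-- An element acting on `A[P]` as a matrix `c • 1` acts on points as `c`. -/
lemma Embedding.exists_smul_eq_of_mem_matrixImage {k : Type} [Field k] {A : AbelianVariety k}
    {E : Type} [Field E] [NumberField E] (S : Embedding A E)
    {P : Ideal S.order} (b : Module.Basis (Fin 2) (S.order ⧸ P) (S.torsion P))
    {x : Matrix.GeneralLinearGroup (Fin 2) (S.order ⧸ P)} (hx : x ∈ S.matrixImage P b)
    {c : S.order} (hxc : (x : Matrix (Fin 2) (Fin 2) (S.order ⧸ P)) = Ideal.Quotient.mk P c • 1) :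
    ∃ σ : AbsGal k, ∀ y ∈ S.torsion P, σ • y = c • y := by
  obtain ⟨σ, hσ⟩ : ∃ σ, S.galRep P σ = Matrix.GeneralLinearGroup.toLin' b x := hx
  refine ⟨σ, fun y hy => ?_⟩
  have h1 := Matrix.GeneralLinearGroup.toLin'_apply b x ⟨y, hy⟩
  rw [hxc, Matrix.smul_mulVec, Matrix.one_mulVec, map_smul, Fintype.linearCombination_apply,
    b.sum_repr, ← hσ] at h1
  exact congrArg Subtype.val h1

/-- If `c ≠ 1` in the field `R ⧸ P` of characteristic `p`, then `c ^ p ^ m ≠ 1` there, as Frobenius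
is injective; so `c ^ p ^ m - 1` is invertible modulo every power of `P`. -/
lemma exists_mul_pow_sub_one_mem {R : Type*} [CommRing R] {p : ℕ} (hp : p.Prime) {P : Ideal R}
    (hP : P.IsMaximal) (hpP : (p : R) ∈ P) {c : R} (hc : c - 1 ∉ P) (m n : ℕ) :
    ∃ a : R, a * (c ^ p ^ m - 1) - 1 ∈ P ^ n := by
  have : Fact p.Prime := ⟨hp⟩
  have hp' := hP.isPrime
  have : CharP (R ⧸ P) p := (CharP.charP_iff_prime_eq_zero hp).2 (by
    rw [← map_natCast (Ideal.Quotient.mk P)]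
    exact Ideal.Quotient.eq_zero_iff_mem.2 hpP)
  have hrP : c ^ p ^ m - 1 ∉ P := by
    rw [← Ideal.Quotient.eq_zero_iff_mem, map_sub, map_one] at hc ⊢
    rw [map_pow, ← one_pow (p ^ m), ← sub_pow_char_pow]
    exact pow_ne_zero _ hc
  have hcop : Ideal.span {c ^ p ^ m - 1} ⊔ P ^ n = ⊤ :=
    Ideal.sup_pow_eq_top (by
      rw [sup_comm]
      exact hP.out.2 _ (left_lt_sup.2 fun h => hrP (h (Ideal.mem_span_singleton_self _))))
  obtain ⟨y, hy, w, hw, hyw⟩ := Submodule.mem_sup.1 (hcop ▸ Submodule.mem_top : (1 : R) ∈ _)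
  obtain ⟨a, rfl⟩ := Ideal.mem_span_singleton'.1 hy
  refine ⟨a, ?_⟩
  rw [← eq_sub_iff_add_eq'] at hyw
  rw [← neg_sub, ← hyw]
  exact neg_mem hw

/-- A nontrivial scalar `c` in the image of Galois on `A[P]` comes from `σ` such that a power of
`σ` acts on `A[P ^ n]` as a scalar `r` with `r - 1` invertible modulo `P ^ n`, which makes the
cohomology of `A[P ^ n]` vanish. -/
lemma Embedding.hasNoScalars_matrixImage {k : Type} [Field k] {A : AbelianVariety k}
    {E : Type} [Field E] [NumberField E] (S : Embedding A E) {p : ℕ} (hp : p.Prime)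
    {P : Ideal S.order} (hP : P.IsMaximal) (hpP : (p : S.order) ∈ P)
    (b : Module.Basis (Fin 2) (S.order ⧸ P) (S.torsion P)) {n : ℕ}
    (hloc : H1loc (S.galImage (P ^ n)) (S.torsion (P ^ n)) ≠ ⊥) :
    HasNoScalars (S.matrixImage P b) := by
  intro x hx c hxc
  obtain ⟨c, rfl⟩ := Ideal.Quotient.mk_surjective c
  by_cases hcP : c - 1 ∈ P
  · refine Units.ext (hxc.trans ?_)
    rw [show Ideal.Quotient.mk P c = 1 from (Ideal.Quotient.eq.2 hcP).trans (map_one _), one_smul]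
    rfl
  obtain ⟨σ, hσ⟩ := S.exists_smul_eq_of_mem_matrixImage b hx hxc
  obtain ⟨a, ha⟩ := exists_mul_pow_sub_one_mem hp hP hpP hcP (n + n) n
  refine absurd (H1loc_eq_bot_of_scalar (Γ := S.galImage (P ^ n))
    (z := S.galRep (P ^ n) (σ ^ p ^ (n + n))) ⟨_, rfl⟩ (a := Ideal.Quotient.mk _ a)
    (r := Ideal.Quotient.mk _ (c ^ p ^ (n + n))) (fun y => ?_) ?_) hloc
  · exact Subtype.ext (S.pow_smul_eq_pow_smul hp hpP hσ n y.2)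
  · rw [← map_one (Ideal.Quotient.mk (P ^ n)), ← map_sub, ← map_mul]
    exact Ideal.Quotient.eq.2 ha

/-! ### Borel subgroup, Sylow subgroup and generators -/

/-- The group-theoretic form of the theorem: a group with no scalars but `1` and with determinants
`𝔽_pˣ` lies in a Borel subgroup and is generated by its Sylow `p`-subgroup and one element. -/
theorem HasNoScalars.exists_sylow_sup_zpowers {F : Type*} [Field F] [Finite F]
    {H : Subgroup (GL (Fin 2) F)} (hH : HasNoScalars H) (p : ℕ) [Fact p.Prime] (hp5 : 5 ≤ p)
    [CharP F p]
    (hdet : ∀ u : Fˣ, (∃ g ∈ H, Matrix.GeneralLinearGroup.det g = u) ↔ ∃ m : ℤ, (u : F) = m) :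
    (∃ B : Subgroup (GL (Fin 2) F), IsBorel B ∧ H ≤ B) ∧
    ∃ N : Sylow p H, (∀ N' : Sylow p H, N' = N) ∧
      ∃ g : H, orderOf g ∣ Nat.card F - 1 ∧
        orderOf (Matrix.GeneralLinearGroup.det (g : GL (Fin 2) F)) = p - 1 ∧
        (N : Subgroup H) ⊔ Subgroup.zpowers g = ⊤ := by
  have hp : p.Prime := Fact.out
  obtain ⟨h, hh, X, y, hXn, hXp, hsup, hy, hord⟩ := hH.exists_normal_sup_zpowers p hp5 hdet
  refine ⟨?_, ?_⟩
  · let B : Subgroup (GL (Fin 2) F) :=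
      { carrier := {g | (h * g * h⁻¹ : GL (Fin 2) F) 1 0 = 0}
        one_mem' := by simp
        mul_mem' := fun {a b} ha hb => by
          have h1 : h * (a * b) * h⁻¹ = (h * a * h⁻¹) * (h * b * h⁻¹) := by group
          rw [Set.mem_ofPred_eq] at ha hb ⊢
          rw [h1, Units.val_mul, mul_apply, Fin.sum_univ_two, ha, hb]
          simp
        inv_mem' := fun {a} ha => by
          have h1 : h * a⁻¹ * h⁻¹ = (h * a * h⁻¹)⁻¹ := by group
          rw [Set.mem_ofPred_eq] at ha ⊢
          rw [h1, Matrix.coe_units_inv, inv_def, adjugate_fin_two]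
          simp [ha] }
    exact ⟨B, ⟨h, fun g => Iff.rfl⟩, hh⟩
  · have hydvd : orderOf y ∣ Nat.card F - 1 := orderOf_dvd_of_pow_eq_one hy
    -- the index of `X` divides the order of `y`, hence `q - 1`
    have hindex : ¬ p ∣ X.index := by
      have h1 : X.index ∣ orderOf y := by
        rw [← Subgroup.relIndex_top_right, ← hsup, Subgroup.relIndex_sup_left,
          ← Nat.card_zpowers]
        exact Subgroup.relIndex_dvd_card _ _
      have hpF : p ∣ Nat.card F := by
        have := Fintype.ofFinite F
        obtain ⟨n, -, hn⟩ := FiniteField.card F p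
        rw [Nat.card_eq_fintype_card, hn]
        exact dvd_pow_self p n.ne_zero
      intro h2
      have h3 := (Nat.dvd_sub_iff_right (Finite.card_pos : 0 < Nat.card F) hpF).1
        (h2.trans (h1.trans hydvd))
      exact hp.one_lt.ne' (Nat.dvd_one.1 h3)
    have hN : ((hXp.toSylow hindex : Sylow p H) : Subgroup H) = X := rfl
    have := Sylow.unique_of_normal (hXp.toSylow hindex) hXn
    exact ⟨hXp.toSylow hindex, fun N' => Subsingleton.elim _ _, y, hydvd, hord, hsup⟩

end GL2Type

theorem proposition8 {k : Type} [Field k] [NumberField k] (A : GL2Type.AbelianVariety k)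
    {E : Type} [Field E] [NumberField E] (S : GL2Type.Embedding A E)
    (p : ℕ) (hp : p.Prime) (hp5 : 5 ≤ p) (hgood : S.IsGood p)
    (hunram : ∀ Q : Ideal (NumberField.RingOfIntegers E), Q.IsPrime →
      (p : NumberField.RingOfIntegers E) ∈ Q → Q.ramificationIdx ℤ = 1)
    (P : Ideal S.order) (hP : P.IsPrime) (hpP : (p : S.order) ∈ P)
    (b : Module.Basis (Fin 2) (S.order ⧸ P) (S.torsion P))
    (hdet : ∀ u : (S.order ⧸ P)ˣ,
      (∃ g ∈ S.matrixImage P b, Matrix.GeneralLinearGroup.det g = u) ↔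
        ∃ m : ℤ, (u : S.order ⧸ P) = m)
    (hloc : ∃ n : ℕ, GL2Type.H1loc (S.galImage (P ^ n)) (S.torsion (P ^ n)) ≠ ⊥) :
    (∃ B : Subgroup (Matrix.GeneralLinearGroup (Fin 2) (S.order ⧸ P)),
      GL2Type.IsBorel B ∧ S.matrixImage P b ≤ B) ∧
    ∃ N : Sylow p (S.matrixImage P b), (∀ N' : Sylow p (S.matrixImage P b), N' = N) ∧
      ∃ g : S.matrixImage P b, orderOf g ∣ Nat.card (S.order ⧸ P) - 1 ∧
        orderOf (Matrix.GeneralLinearGroup.det (g : Matrix.GeneralLinearGroup (Fin 2) (S.order ⧸ P)))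
          = p - 1 ∧
        (N : Subgroup (S.matrixImage P b)) ⊔ Subgroup.zpowers g = ⊤ := by
  obtain ⟨n, hn⟩ := hloc
  have : Fact p.Prime := ⟨hp⟩
  have hfin : Finite (S.order ⧸ P) := GL2Type.finite_quotient hp S.order P hpP
  have hmax : P.IsMaximal :=
    Ideal.Quotient.maximal_of_isField P (Finite.isField_of_domain (S.order ⧸ P))
  have : CharP (S.order ⧸ P) p := (CharP.charP_iff_prime_eq_zero hp).2 (by
    rw [← map_natCast (Ideal.Quotient.mk P)]
    exact Ideal.Quotient.eq_zero_iff_mem.2 hpP)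
  let _ : Field (S.order ⧸ P) := Ideal.Quotient.field P
  exact (S.hasNoScalars_matrixImage hp hmax hpP b hn).exists_sylow_sup_zpowers p hp5 hdet
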